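/- **Theorem (existence and uniqueness for one BDF2 step).** Let $\Omega=\{q\in\mathbb R^3:|q|<1\}$ and, for $s\in\mathbb R$, let $(f,g)_s=\int_\Omega f\,g\,(1-|q|^2)^s\,dq$ (with $f\,g$ replaced by the dot product $f\cdot g$ for vector fields). Let $L^2_s(\Omega)$ be the space of (classes of) measurable functions $f$ with $(f,f)_s<\infty$, and let $H^1_s(\Omega)$ be the space of $u\in L^2_s(\Omega)$ whose distributional gradient $\nabla u$ belongs to $L^2_s(\Omega;\mathbb R^3)$. Let $b,s,\mathrm{De},\Delta t$ be real numbers with $\mathrm{De}>0$, $\Delta t>0$ and $1<s\le b/2$, and let $K$ be a real $3\times 3$ matrix. If $s<b/2$, assume in addition that $$\frac{3}{2\Delta t}>\frac{b-2s}{\mathrm{De}}\,\gamma(s),\qquad \gamma(s)=\frac34\Bigl(1+\frac{s-1}{3}+\frac{3}{4(s-1)}\Bigr).$$ Then for all $u,g\in H^1_s(\Omega)$ the integral $\bigl(u,\tfrac{q\cdot\nabla g}{1-|q|^2}\bigr)_s$ converges absolutely, and for all $h^n,h^{n-1}\in L^2_s(\Omega)$ there is exactly one $h^{n+1}\in H^1_s(\Omega)$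 such that, for every $g\in H^1_s(\Omega)$, $$\frac{1}{2\Delta t}\bigl(3h^{n+1}-4h^n+h^{n-1},g\bigr)_s+\frac1{\mathrm{De}}\bigl(\nabla h^{n+1},\nabla g\bigr)_s+\frac{b-2s}{\mathrm{De}}\Bigl(h^{n+1},\frac{q\cdot\nabla g}{1-|q|^2}\Bigr)_s=\bigl(2h^n-h^{n-1},(Kq)\cdot\nabla g\bigr)_s .$$ -/

import Mathlib

open MeasureTheory
open scoped ContDiff

noncomputable section

namespace FENE

/-- The three-dimensional configuration space with its Euclidean norm. -/
abbrev Config : Type := EuclideanSpace ℝ (Fin 3)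

/-- The open unit ball (its boundary sphere is a Lebesgue null set). -/
def Ω : Set Config := Metric.ball 0 1

/-- The measure `(1 - |q|²)^s dq` on the unit ball. -/
def weightMeasure (s : ℝ) : Measure Config :=
  (volume.restrict Ω).withDensity fun q => ENNReal.ofReal ((1 - ‖q‖ ^ 2) ^ s)

/-- The weighted space `L²_s(Ω)` of real functions modulo almost everywhere equality. -/
abbrev L2 (s : ℝ) : Type := Lp ℝ 2 (weightMeasure s)

/-- The weighted space `L²_s(Ω; ℝ³)` of vector fields. -/
abbrev L2Vec (s : ℝ) : Type := Lp Config 2 (weightMeasure s)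

/-- The weighted inner product `(f, g)_s = ∫_Ω f g (1 - |q|²)^s dq` of scalar functions. -/
def ip (s : ℝ) (f g : Config → ℝ) : ℝ := ∫ q, f q * g q ∂(weightMeasure s)

theorem isOpen_Ω : IsOpen Ω := Metric.isOpen_ball
theorem weight_pos {s : ℝ} {q : Config} (hq : q ∈ Ω) : 0 < (1 - ‖q‖ ^ 2) ^ s := by
  have : ‖q‖ < 1 := by simpa [Ω] using hq
  exact Real.rpow_pos_of_pos (by nlinarith [norm_nonneg q]) s

/-- The explicit form of the weighted inner product. -/
theorem ip_eq (s : ℝ) (f g : Config → ℝ) :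
    ip s f g = ∫ q in Ω, f q * g q * (1 - ‖q‖ ^ 2) ^ s := by
  unfold ip weightMeasure
  rw [integral_withDensity_eq_integral_toReal_smul (by fun_prop) (by simp)]
  refine setIntegral_congr_fun isOpen_Ω.measurableSet fun q hq => ?_
  simp only [ENNReal.toReal_ofReal (weight_pos (s := s) hq).le, smul_eq_mul]
  ring

/-- The weighted inner product `(F, G)_s = ∫_Ω F · G (1 - |q|²)^s dq` of vector fields. -/
def ipVec (s : ℝ) (F G : Config → Config) : ℝ := ∫ q, inner ℝ (F q) (G q) ∂(weightMeasure s)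

/-- `G` is the distributional gradient of `u` in the open ball:
`∫_Ω u ∂ᵢφ dq = - ∫_Ω Gᵢ φ dq` (Lebesgue measure) for all `φ ∈ C_c^∞(Ω)` and all `i`. -/
def IsWeakGradient (u : Config → ℝ) (G : Config → Config) : Prop :=
  ∀ φ : Config → ℝ, ContDiff ℝ ∞ φ → HasCompactSupport φ → tsupport φ ⊆ Ω → ∀ i : Fin 3,
    ∫ q in Ω, u q * fderiv ℝ φ q (EuclideanSpace.single i 1) = - ∫ q in Ω, G q i * φ q

/-- The weighted Sobolev space `H¹_s(Ω)`: functions in `L²_s(Ω)` whose distributional gradient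
is in `L²_s(Ω; ℝ³)`. -/
def H1 (s : ℝ) : Set (L2 s) := {u | ∃ G : L2Vec s, IsWeakGradient u G}

/-- The weak gradient `∇u ∈ L²_s(Ω; ℝ³)` of `u ∈ H¹_s(Ω)`. -/
def grad {s : ℝ} (u : H1 s) : L2Vec s := u.2.choose

theorem isWeakGradient_grad {s : ℝ} (u : H1 s) : IsWeakGradient (u : L2 s) (grad u) :=
  u.2.choose_spec

theorem locallyIntegrableOn_coe {s : ℝ} {F : Type*} [NormedAddCommGroup F] [NormedSpace ℝ F]
    (G : Lp F 2 (weightMeasure s)) : LocallyIntegrableOn G Ω := by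
  rw [locallyIntegrableOn_iff isOpen_Ω.isLocallyClosed]
  intro k hk hkc
  have hcont : ContinuousOn (fun q : Config => (1 - ‖q‖ ^ 2) ^ s) k := by
    refine ContinuousOn.rpow_const (by fun_prop) fun q hq => Or.inl ?_
    have : ‖q‖ < 1 := by simpa [Ω] using hk hq
    nlinarith [norm_nonneg q]
  obtain ⟨c, hc, hcb⟩ : ∃ c : ℝ, 0 < c ∧ ∀ q ∈ k, c ≤ (1 - ‖q‖ ^ 2) ^ s := by
    rcases k.eq_empty_or_nonempty with rfl | hne
    · exact ⟨1, one_pos, by simp⟩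
    · obtain ⟨x, hx, hxm⟩ := hkc.exists_isMinOn hne hcont
      exact ⟨_, weight_pos (hk hx), fun q hq => hxm hq⟩
  have hle : volume.restrict k ≤ (ENNReal.ofReal c)⁻¹ • weightMeasure s := by
    have h0 : ENNReal.ofReal c ≠ 0 := by simpa using hc
    have h1 : ENNReal.ofReal c • volume.restrict k ≤ weightMeasure s := by
      unfold weightMeasure
      rw [← withDensity_const]
      calc _ = (volume.restrict k).withDensity (fun _ => ENNReal.ofReal c) := rfl
        _ ≤ (volume.restrict k).withDensity (fun q => ENNReal.ofReal ((1 - ‖q‖ ^ 2) ^ s)) := by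
            refine withDensity_mono ?_
            filter_upwards [ae_restrict_mem hkc.measurableSet] with q hq
            exact ENNReal.ofReal_le_ofReal (hcb q hq)
        _ ≤ _ := by
            rw [Measure.le_iff]
            intro t ht
            rw [withDensity_apply _ ht, withDensity_apply _ ht]
            exact lintegral_mono' (Measure.restrict_mono_measure
              (Measure.restrict_mono_set _ hk) t) le_rfl
    calc volume.restrict k = (ENNReal.ofReal c)⁻¹ • ENNReal.ofReal c • volume.restrict k := by
          rw [smul_smul, ENNReal.inv_mul_cancel h0 ENNReal.ofReal_ne_top, one_smul]
      _ ≤ _ := by gcongr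
  have h2 : MemLp G 2 (volume.restrict k) :=
    (Lp.memLp G).of_measure_le_smul (by simpa using hc) hle
  have : IsFiniteMeasure (volume.restrict k) := ⟨by simpa using hkc.measure_lt_top⟩
  exact h2.integrable (by norm_num)

/-- The weak gradient is unique, so `grad u` does not depend on a choice. -/
theorem grad_unique {s : ℝ} (u : H1 s) (G : L2Vec s) (hG : IsWeakGradient (u : L2 s) G) :
    G = grad u := by
  have hco : ∀ i : Fin 3, ∀ᵐ q ∂(volume.restrict Ω), G q i - grad u q i = 0 := by
    intro i
    have hl : ∀ H : L2Vec s, LocallyIntegrableOn (fun q => H q i) Ω := by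
      intro H x hx
      obtain ⟨t, ht, hi⟩ := locallyIntegrableOn_coe H x hx
      exact ⟨t, ht, (EuclideanSpace.proj (𝕜 := ℝ) i).integrable_comp hi⟩
    have := isOpen_Ω.ae_eq_zero_of_integral_contDiff_smul_eq_zero (μ := volume)
      (f := fun q => G q i - grad u q i) ((hl G).sub (hl (grad u))) ?_
    · exact (ae_restrict_iff' isOpen_Ω.measurableSet).2 this
    intro φ hφ hc hs
    have key : ∀ H : L2Vec s, Integrable (fun q => φ q • H q i) := by
      intro H
      have hi : IntegrableOn (fun q => H q i) (tsupport φ) :=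
        (hl H).integrableOn_compact_subset hs hc
      have h2 : IntegrableOn (fun q => φ q • H q i) (tsupport φ) :=
        hi.continuousOn_smul hφ.continuous.continuousOn hc
      refine (integrableOn_iff_integrable_of_support_subset ?_).1 h2
      intro q hq
      refine subset_tsupport φ fun h => hq ?_
      simp [h]
    have e : ∀ H : L2Vec s, ∫ q, φ q • H q i = ∫ q in Ω, H q i * φ q := by
      intro H
      rw [← setIntegral_eq_integral_of_forall_compl_eq_zero (s := Ω)]
      · simp [mul_comm]
      · intro q hq
        have : φ q = 0 := image_eq_zero_of_notMem_tsupport fun h => hq (hs h)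
        simp [this]
    simp only [smul_sub]
    rw [integral_sub (key G) (key (grad u)), e, e, sub_eq_zero]
    exact neg_injective ((hG φ hφ hc hs i).symm.trans (isWeakGradient_grad u φ hφ hc hs i))
  refine Lp.ext ?_
  have h3 : ∀ᵐ q ∂(volume.restrict Ω), G q = grad u q := by
    filter_upwards [hco 0, hco 1, hco 2] with q h0 h1 h2
    ext i
    fin_cases i <;> simp_all [sub_eq_zero]
  exact (withDensity_absolutelyContinuous _ _).ae_le h3

/-- The function `(q · G(q)) / (1 - |q|²)`, for `G = ∇g` the factor in the FENE potential term. -/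
def radial (G : Config → Config) (q : Config) : ℝ := inner ℝ q (G q) / (1 - ‖q‖ ^ 2)

/-- The function `(K q) · G(q)`. -/
def convect (K : Matrix (Fin 3) (Fin 3) ℝ) (G : Config → Config) (q : Config) : ℝ :=
  inner ℝ (Matrix.toEuclideanLin K q) (G q)

/-- The threshold `γ(s)`. -/
def gammaThreshold (s : ℝ) : ℝ := 3 / 4 * (1 + (s - 1) / 3 + 3 / (4 * (s - 1)))

/-- One step of the semi-implicit BDF2 scheme in variational form: `hnext` is the new iterate
`h^{n+1}`, `hcur` is `h^n` and `hprev` is `h^{n-1}`. -/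
def IsBDF2Step (b De Δt s : ℝ) (K : Matrix (Fin 3) (Fin 3) ℝ) (hcur hprev : L2 s)
    (hnext : H1 s) : Prop :=
  ∀ g : H1 s,
    1 / (2 * Δt) * ip s (fun q => 3 * (hnext : L2 s) q - 4 * hcur q + hprev q) (g : L2 s)
      + 1 / De * ipVec s (grad hnext) (grad g)
      + (b - 2 * s) / De * ip s (hnext : L2 s) (radial (grad g))
    = ip s (fun q => 2 * hcur q - hprev q) (convect K (grad g))

end FENE

end

noncomputable section

namespace FENE

open Filter Topology

/-! The scheme is a Lax–Milgram problem on H¹_s, and the only delicate term is the potential (u,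
q·∇g / w)_s with w = 1 - |q|², which is singular at the sphere.

Both its boundedness and its sign come from one integration by parts. Testing ∇(u²) = 2u∇u against
the field q w^(s-1), whose divergence is (2s+1) w^(s-1) - 2(s-1) w^(s-2), gives formally 2 (u, q·∇u
/ w)_s = ∫ u² (2(s-1) w⁻² - (2s+1) w⁻¹) w^s. No density of smooth functions up to the boundary is
used: the field is cut off near the sphere by a function nondecreasing in w, so the extra term has a
favourable sign and the identity becomes "≥" (`IsWeakGradient.integral_sq_mul_cutoff_le`).

Since s > 1, absorbing the lower order terms and letting the cutoff tend to 1 yields Hardy's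
inequality: u / w ∈ L²_s, controlled by the H¹_s norm (`IsWeakGradient.integrable_sq_mul_inv_sq`).
Hence the potential term converges and is bounded. Minimising the quadratic in w⁻¹ instead gives (u,
q·∇u / w)_s ≥ -γ(s) ‖u‖² (`IsWeakGradient.neg_gammaThreshold_mul_le`), and the step size condition
is exactly what makes the form coercive.

H¹_s enters as the graph W of the weak gradient, a closed subspace of L²_s × L²_s(Ω; ℝ³), hence
complete. -/

/-! ### Mollification paired with L² functions -/

/-- Translations act strongly continuously on L², and the integral is an inner product with a
translate. -/
theorem continuous_integral_mul_translate {F H : Config → ℝ} (hF : MemLp F 2 volume)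
    (hH : MemLp H 2 volume) : Continuous fun z => ∫ x, F x * H (z + x) := by
  have : Fact ((2 : ENNReal) ≠ ⊤) := ⟨by norm_num⟩
  have hcont : Continuous fun z : Config =>
      inner ℝ (hF.toLp F) (DomAddAct.mk z +ᵥ hH.toLp H) :=
    continuous_const.inner ((DomAddAct.continuous_mk).vadd continuous_const)
  convert hcont using 2 with z
  rw [L2.inner_def]
  refine integral_congr_ae ?_
  have h2 : MemLp (fun x => H (z +ᵥ x)) 2 volume :=
    hH.comp_measurePreserving (measurePreserving_vadd z volume)
  rw [DomAddAct.mk_vadd_toLp]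
  filter_upwards [hF.coeFn_toLp, h2.coeFn_toLp] with x h1 h2
  rw [h1]
  erw [h2]
  simp [mul_comm]

theorem integral_mul_convolution_eq {F H ρ : Config → ℝ} (hF : MemLp F 2 volume)
    (hH : MemLp H 2 volume) (hρ : Continuous ρ) (hρc : HasCompactSupport ρ) :
    ∫ x, F x * ∫ t, H t * ρ (x - t) = ∫ z, ρ z * ∫ x, F x * H (-z + x) := by
  have hρi : Integrable ρ := hρ.integrable_of_hasCompactSupport hρc
  have hHz : ∀ z, MemLp (fun x => H (-z + x)) 2 volume := fun z =>
    hH.comp_measurePreserving (measurePreserving_add_left volume (-z))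
  have hmeas : AEStronglyMeasurable (fun p : Config × Config => F p.1 * (H (-p.2 + p.1) * ρ p.2))
      (volume.prod volume) := by
    refine hF.1.comp_fst.mul (AEStronglyMeasurable.mul ?_ hρ.aestronglyMeasurable.comp_snd)
    have h := hH.1.comp_quasiMeasurePreserving (quasiMeasurePreserving_sub volume volume)
    refine h.congr (Eventually.of_forall fun p => ?_)
    simp [sub_eq_neg_add]
  have hint : Integrable (fun p : Config × Config => F p.1 * (H (-p.2 + p.1) * ρ p.2))
      (volume.prod volume) := by
    rw [integrable_prod_iff' hmeas]
    refine ⟨Eventually.of_forall fun z => ?_, ?_⟩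
    · have := (hF.integrable_mul (hHz z)).mul_const (ρ z)
      simpa [mul_assoc] using this
    -- Absolute convergence for Fubini: the correlation of |F| and |H| is continuous, so its product
    -- with the compactly supported |ρ| is integrable.
    · have hc : Continuous fun z : Config => ∫ x, |F x| * |H (-z + x)| :=
        (continuous_integral_mul_translate hF.abs hH.abs).comp continuous_neg
      have : Integrable fun z => (∫ x, |F x| * |H (-z + x)|) * |ρ z| :=
        (hc.mul hρ.abs).integrable_of_hasCompactSupport (hρc.abs.mul_left)
      refine this.congr (Eventually.of_forall fun z => ?_)
      simp only [norm_mul, Real.norm_eq_abs, ← integral_mul_const, mul_assoc]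
  calc ∫ x, F x * ∫ t, H t * ρ (x - t) = ∫ x, ∫ z, F x * (H (-z + x) * ρ z) := by
        refine integral_congr_ae (Eventually.of_forall fun x => ?_)
        simp only
        rw [integral_const_mul, ← integral_sub_left_eq_self (fun t => H t * ρ (x - t)) volume x]
        simp [sub_eq_neg_add]
    _ = ∫ z, ∫ x, F x * (H (-z + x) * ρ z) := integral_integral_swap hint
    _ = _ := by
        refine integral_congr_ae (Eventually.of_forall fun z => ?_)
        simp only
        rw [← integral_const_mul]
        congr 1 with x
        ring

/-- After Fubini the left side is the correlation of F and H mollified at the origin, and that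
correlation is continuous. This weak convergence is all the product rule below needs. -/
theorem tendsto_integral_mul_mollify {F H : Config → ℝ} (hF : MemLp F 2 volume)
    (hH : MemLp H 2 volume) {φ : ℕ → ContDiffBump (0 : Config)}
    (hφ : Tendsto (fun n => (φ n).rOut) atTop (𝓝 0)) :
    Tendsto (fun n => ∫ x, F x * ∫ t, H t * (φ n).normed volume (x - t)) atTop
      (𝓝 (∫ x, F x * H x)) := by
  have h := ContDiffBump.convolution_tendsto_right_of_continuous (μ := (volume : Measure Config))
    hφ (continuous_integral_mul_translate hF hH) 0
  simp only [zero_add] at h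
  refine h.congr fun n => ?_
  rw [integral_mul_convolution_eq hF hH (φ n).continuous_normed (φ n).hasCompactSupport_normed]
  simp [convolution]

theorem hasFDerivAt_mollify_apply {U ρ : Config → ℝ} (hU : LocallyIntegrable U)
    (hρ : ContDiff ℝ ∞ ρ) (hρc : HasCompactSupport ρ) :
    ContDiff ℝ ∞ (fun x => ∫ t, U t * ρ (x - t)) ∧ ∀ x v,
      fderiv ℝ (fun x => ∫ t, U t * ρ (x - t)) x v = ∫ t, U t * fderiv ℝ ρ (x - t) v := by
  have e : (fun x => ∫ t, U t * ρ (x - t)) =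
      convolution U ρ (ContinuousLinearMap.lsmul ℝ ℝ) volume := by
    ext x; simp [convolution]
  rw [e]
  refine ⟨hρc.contDiff_convolution_right _ hU hρ, fun x v => ?_⟩
  have h1 : ContDiff ℝ 1 ρ := hρ.of_le (by norm_cast)
  rw [(hρc.hasFDerivAt_convolution_right _ hU h1 x).fderiv,
    convolution_precompR_apply _ hU (hρc.fderiv ℝ) (h1.continuous_fderiv one_ne_zero)]
  simp [convolution]

/-! ### The rule ∇(u²) = 2u∇u for weak gradients -/

/-- With M a mollification of u, the product M φ is an admissible test function, and on the support
of φ the derivative of M is the mollified gradient. Removing the mollification leaves u² ∂φ and two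
equal terms u G φ. -/
theorem IsWeakGradient.integral_sq_mul_fderiv {u : Config → ℝ} {G : Config → Config}
    (h : IsWeakGradient u G) (hu : ∀ k ⊆ Ω, IsCompact k → MemLp u 2 (volume.restrict k))
    (hG : ∀ k ⊆ Ω, IsCompact k → MemLp G 2 (volume.restrict k)) {φ : Config → ℝ}
    (hφ : ContDiff ℝ ∞ φ) (hφc : HasCompactSupport φ) (hφs : tsupport φ ⊆ Ω) (i : Fin 3) :
    ∫ q in Ω, u q ^ 2 * fderiv ℝ φ q (EuclideanSpace.single i 1) =
      - ∫ q in Ω, 2 * (u q * G q i) * φ q := by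
  set e : Config := EuclideanSpace.single i 1
  -- A margin δ around the support of φ: truncating u and G to k gives global L² functions without
  -- changing any integral near that support.
  obtain ⟨δ, hδ, hk⟩ := hφc.isCompact.exists_cthickening_subset_open isOpen_Ω hφs
  set k := Metric.cthickening δ (tsupport φ)
  have hkc : IsCompact k := hφc.isCompact.cthickening
  have hkm : MeasurableSet k := hkc.measurableSet
  have hsk : tsupport φ ⊆ k := Metric.self_subset_cthickening _
  set U := k.indicator u with hU
  set g := k.indicator (fun q => G q i) with hg
  have hUL : MemLp U 2 volume := (memLp_indicator_iff_restrict hkm).2 (hu k hk hkc)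
  have hgL : MemLp g 2 volume := (memLp_indicator_iff_restrict hkm).2
    ((EuclideanSpace.proj (𝕜 := ℝ) i).comp_memLp' (hG k hk hkc))
  have hUl : LocallyIntegrable U := hUL.locallyIntegrable (by norm_num)
  have hzero : ∀ x ∉ k, φ x = 0 := fun x hx => image_eq_zero_of_notMem_tsupport fun h' => hx (hsk h')
  have hzero' : ∀ x ∉ tsupport φ, fderiv ℝ φ x e = 0 := fun x hx => by
    rw [image_eq_zero_of_notMem_tsupport (f := fderiv ℝ φ) fun h' => hx (tsupport_fderiv_subset ℝ h')]
    rfl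
  have hdc : Continuous fun x => fderiv ℝ φ x e :=
    (hφ.continuous_fderiv (by simp)).clm_apply continuous_const
  have hdcs : HasCompactSupport fun x => fderiv ℝ φ x e := hφc.fderiv_apply ℝ e
  have toU : ∀ f : Config → ℝ, (∀ x ∉ tsupport φ, f x = 0) →
      ∫ q in Ω, u q * f q = ∫ q, U q * f q := by
    intro f hf
    rw [setIntegral_eq_integral_of_forall_compl_eq_zero
      (fun x hx => by rw [hf x fun h' => hx (hφs h'), mul_zero])]
    congr 1 with x
    by_cases hx : x ∈ k
    · simp [hU, hx]
    · rw [hf x fun h' => hx (hsk h')]; simp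
  have toG : ∀ f : Config → ℝ, (∀ x ∉ tsupport φ, f x = 0) →
      ∫ q in Ω, G q i * f q = ∫ q, g q * f q := by
    intro f hf
    rw [setIntegral_eq_integral_of_forall_compl_eq_zero
      (fun x hx => by rw [hf x fun h' => hx (hφs h'), mul_zero])]
    congr 1 with x
    by_cases hx : x ∈ k
    · simp [hg, hx]
    · rw [hf x fun h' => hx (hsk h')]; simp
  -- Radii at most δ keep every kernel centred at a point of `tsupport φ` inside k, where U and u
  -- coincide.
  let b : ℕ → ContDiffBump (0 : Config) := fun n =>
    ⟨δ / (n + 1) / 2, δ / (n + 1), by positivity, half_lt_self (by positivity)⟩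
  have hb : Tendsto (fun n => (b n).rOut) atTop (𝓝 0) := by
    simpa [b, div_eq_mul_inv] using (tendsto_one_div_add_atTop_nhds_zero_nat (𝕜 := ℝ)).const_mul δ
  have hbδ : ∀ n, (b n).rOut ≤ δ := fun n => div_le_self hδ.le (by linarith [n.cast_nonneg (α := ℝ)])
  set ρ : ℕ → Config → ℝ := fun n => (b n).normed volume with hρ
  have hρs : ∀ n, ContDiff ℝ ∞ (ρ n) := fun n => (b n).contDiff_normed
  have hρc : ∀ n, HasCompactSupport (ρ n) := fun n => (b n).hasCompactSupport_normed
  set M : ℕ → Config → ℝ := fun n x => ∫ t, U t * ρ n (x - t) with hM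
  have hMs : ∀ n, ContDiff ℝ ∞ (M n) := fun n =>
    (hasFDerivAt_mollify_apply hUl (hρs n) (hρc n)).1
  have hρsupp : ∀ n, ∀ x ∈ tsupport φ, tsupport (fun t => ρ n (x - t)) ⊆ k := by
    intro n x hx
    have hcl : IsClosed {t : Config | dist x t ≤ δ} := isClosed_le (by fun_prop) continuous_const
    refine (closure_minimal (fun t ht => ?_) hcl).trans fun t ht =>
      Metric.mem_cthickening_of_dist_le t x δ _ hx (by rw [dist_comm]; exact ht)
    have : x - t ∈ Function.support ((b n).normed volume) := ht
    rw [(b n).support_normed_eq, mem_ball_zero_iff] at this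
    rw [Set.mem_ofPred_eq, dist_eq_norm]
    exact this.le.trans (hbδ n)
  -- The kernel t ↦ ρ(x - t) is itself a test function in Ω; its derivative in t is minus the
  -- derivative in x, which cancels the sign in the definition of the weak gradient.
  have hMd : ∀ n, ∀ x ∈ tsupport φ, fderiv ℝ (M n) x e = ∫ t, g t * ρ n (x - t) := by
    intro n x hx
    rw [(hasFDerivAt_mollify_apply hUl (hρs n) (hρc n)).2]
    have hψs : ContDiff ℝ ∞ fun t => ρ n (x - t) := (hρs n).comp (contDiff_const.sub contDiff_id)
    have hψc : HasCompactSupport fun t => ρ n (x - t) :=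
      hkc.of_isClosed_subset (isClosed_tsupport _) (hρsupp n x hx)
    have hψd : ∀ t, fderiv ℝ (fun t => ρ n (x - t)) t e = - fderiv ℝ (ρ n) (x - t) e := by
      intro t
      have h1 : HasFDerivAt (fun t => ρ n (x - t))
          ((fderiv ℝ (ρ n) (x - t)).comp (-ContinuousLinearMap.id ℝ Config)) t :=
        (((hρs n).differentiable (by simp)) (x - t)).hasFDerivAt.comp t
          ((hasFDerivAt_id t).const_sub x)
      rw [h1.fderiv]; simp
    have key := h _ hψs hψc ((hρsupp n x hx).trans hk) i
    rw [setIntegral_eq_integral_of_forall_compl_eq_zero,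
      setIntegral_eq_integral_of_forall_compl_eq_zero] at key
    · have e1 : ∀ t, U t * fderiv ℝ (ρ n) (x - t) e =
          - (u t * fderiv ℝ (fun t => ρ n (x - t)) t e) := by
        intro t
        by_cases ht : t ∈ k
        · simp [hU, ht, hψd]
        · rw [image_eq_zero_of_notMem_tsupport (f := fderiv ℝ fun t => ρ n (x - t))
            fun h' => ht (hρsupp n x hx (tsupport_fderiv_subset ℝ h'))]
          simp [hU, ht]
      have e2 : ∀ t, g t * ρ n (x - t) = G t i * ρ n (x - t) := by
        intro t
        by_cases ht : t ∈ k
        · simp [hg, ht]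
        · have : ρ n (x - t) = 0 := image_eq_zero_of_notMem_tsupport
            (f := fun t => ρ n (x - t)) fun h' => ht (hρsupp n x hx h')
          simp [this]
      simp only [e1, e2, integral_neg]
      exact neg_eq_iff_eq_neg.2 key
    · intro t ht
      have : ρ n (x - t) = 0 := image_eq_zero_of_notMem_tsupport
        (f := fun t => ρ n (x - t)) fun h' => ht (hk (hρsupp n x hx h'))
      simp [this]
    · intro t ht
      rw [image_eq_zero_of_notMem_tsupport (f := fderiv ℝ fun t => ρ n (x - t))
        fun h' => ht (hk (hρsupp n x hx (tsupport_fderiv_subset ℝ h')))]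
      simp
  have mulL : ∀ {f : Config → ℝ} {c : Config → ℝ}, MemLp f 2 volume → Continuous c →
      HasCompactSupport c → MemLp (fun x => f x * c x) 2 volume := by
    intro f c hf hc hcs
    obtain ⟨C, hC⟩ := hc.bounded_above_of_compact_support hcs
    refine (hf.const_mul C).mono (hf.1.mul hc.aestronglyMeasurable)
      (Eventually.of_forall fun x => ?_)
    rw [norm_mul, norm_mul, mul_comm]
    exact mul_le_mul_of_nonneg_right ((hC x).trans (le_abs_self C)) (norm_nonneg _)
  have intL : ∀ {f : Config → ℝ} {c : Config → ℝ}, MemLp f 2 volume → Continuous c →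
      HasCompactSupport c → Integrable (fun x => f x * c x) := by
    intro f c hf hc hcs
    exact hf.integrable_mul (hc.memLp_of_hasCompactSupport (p := 2) hcs)
  have main : ∀ n, (∫ x, (U x * fderiv ℝ φ x e) * ∫ t, U t * ρ n (x - t)) +
      (∫ x, (U x * φ x) * ∫ t, g t * ρ n (x - t)) =
      - ∫ x, (g x * φ x) * ∫ t, U t * ρ n (x - t) := by
    intro n
    have hts : tsupport (fun x => M n x * φ x) ⊆ tsupport φ := tsupport_mul_subset_right
    have key := h _ ((hMs n).mul hφ) (hφc.mul_left) (hts.trans hφs) i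
    have hfd : ∀ x, fderiv ℝ (fun x => M n x * φ x) x e =
        M n x * fderiv ℝ φ x e + φ x * fderiv ℝ (M n) x e := by
      intro x
      rw [fderiv_fun_mul ((hMs n).differentiable (by simp) x) (hφ.differentiable (by simp) x)]
      simp
    rw [toU _ (fun x hx => by
        rw [image_eq_zero_of_notMem_tsupport (f := fderiv ℝ fun x => M n x * φ x)
          fun h' => hx (hts (tsupport_fderiv_subset ℝ h'))]; rfl),
      toG _ (fun x hx => by rw [image_eq_zero_of_notMem_tsupport hx, mul_zero])] at key
    have e3 : ∫ x, (g x * φ x) * ∫ t, U t * ρ n (x - t) = ∫ q, g q * (M n q * φ q) := by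
      congr 1 with x; ring
    rw [e3, ← key, ← integral_add]
    · congr 1 with x
      rw [hfd]
      by_cases hx : x ∈ tsupport φ
      · rw [hMd n x hx]; ring
      · rw [image_eq_zero_of_notMem_tsupport hx, hzero' x hx]; ring
    · have := intL hUL ((hMs n).continuous.mul hdc) hdcs.mul_left
      refine this.congr (Eventually.of_forall fun x => ?_)
      simp only [Pi.mul_apply, hM]; ring
    · have hc : Continuous fun x => fderiv ℝ (M n) x e :=
        ((hMs n).continuous_fderiv (by simp)).clm_apply continuous_const
      have := intL hUL (hc.mul hφ.continuous) hφc.mul_left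
      refine this.congr (Eventually.of_forall fun x => ?_)
      by_cases hx : x ∈ tsupport φ
      · simp only [Pi.mul_apply, hMd n x hx]; ring
      · simp [image_eq_zero_of_notMem_tsupport hx]
  have l1 := tendsto_integral_mul_mollify (mulL hUL hdc hdcs) hUL hb
  have l2 := tendsto_integral_mul_mollify (mulL hUL hφ.continuous hφc) hgL hb
  have l3 := tendsto_integral_mul_mollify (mulL hgL hφ.continuous hφc) hUL hb
  have lim := tendsto_nhds_unique ((l1.add l2).congr main) l3.neg
  have f1 : ∫ q in Ω, u q ^ 2 * fderiv ℝ φ q e = ∫ x, U x * fderiv ℝ φ x e * U x := by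
    rw [setIntegral_eq_integral_of_forall_compl_eq_zero
      (fun x hx => by rw [hzero' x fun h' => hx (hφs h'), mul_zero])]
    congr 1 with x
    by_cases hx : x ∈ k
    · simp only [hU, Set.indicator_of_mem hx]; ring
    · rw [hzero' x fun h' => hx (hsk h')]; ring
  have f2 : ∫ q in Ω, 2 * (u q * G q i) * φ q = 2 * ∫ x, U x * φ x * g x := by
    rw [setIntegral_eq_integral_of_forall_compl_eq_zero
      (fun x hx => by rw [hzero x fun h' => hx (hk h'), mul_zero]), ← integral_const_mul]
    congr 1 with x
    by_cases hx : x ∈ k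
    · simp only [hU, hg, Set.indicator_of_mem hx]; ring
    · rw [hzero x hx]; ring
  have f3 : ∫ x, g x * φ x * U x = ∫ x, U x * φ x * g x := by congr 1 with x; ring
  rw [f1, f2]
  linarith

/-! ### Radial cutoffs and truncated weights -/

/-- A smooth nondecreasing cutoff in the variable `w = 1 - |q|²`: it vanishes for `w ≤ 1 / N` and
equals `1` for `w ≥ 2 / N`. -/
def cutoff (N w : ℝ) : ℝ := Real.smoothTransition (N * w - 1)

theorem cutoff_nonneg (N w : ℝ) : 0 ≤ cutoff N w := Real.smoothTransition.nonneg _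

theorem cutoff_le_one (N w : ℝ) : cutoff N w ≤ 1 := Real.smoothTransition.le_one _

theorem cutoff_eq_zero {N w : ℝ} (h : N * w ≤ 1) : cutoff N w = 0 :=
  Real.smoothTransition.zero_of_nonpos (by linarith)

theorem contDiff_cutoff (N : ℝ) : ContDiff ℝ ∞ (cutoff N) :=
  Real.smoothTransition.contDiff.comp (by fun_prop)

theorem deriv_cutoff_nonneg {N : ℝ} (hN : 0 ≤ N) (w : ℝ) : 0 ≤ deriv (cutoff N) w :=
  Monotone.deriv_nonneg fun a b hab => Real.smoothTransition.monotone (by gcongr)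

/-- Where the cutoff is nonzero, w⁻¹ < N. Thus all truncated singular weights are bounded, and their
integrals exist before Hardy's inequality is known. -/
theorem inv_pow_mul_cutoff_le {N w : ℝ} (hw : 0 < w) (hN : 0 ≤ N) (j : ℕ) :
    w⁻¹ ^ j * cutoff N w ≤ N ^ j := by
  rcases le_or_gt (N * w) 1 with h | h
  · rw [cutoff_eq_zero h, mul_zero]; positivity
  · calc w⁻¹ ^ j * cutoff N w ≤ w⁻¹ ^ j * 1 := by gcongr; exact cutoff_le_one N w
      _ ≤ N ^ j := by
        rw [mul_one]
        gcongr
        rw [inv_le_iff_one_le_mul₀ hw]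
        exact h.le

theorem tendsto_cutoff {w : ℝ} (hw : 0 < w) :
    Tendsto (fun n : ℕ => cutoff n w) atTop (𝓝 1) := by
  have h : Tendsto (fun n : ℕ => (n : ℝ) * w) atTop atTop :=
    tendsto_natCast_atTop_atTop.atTop_mul_const hw
  refine tendsto_const_nhds.congr' ?_
  filter_upwards [h.eventually_ge_atTop 2] with n hn
  exact (Real.smoothTransition.one_of_one_le (by linarith)).symm

/-- The truncated radial weight `w ^ a` at `w = 1 - r`. -/
def truncWeight (a N r : ℝ) : ℝ := (1 - r) ^ a * cutoff N (1 - r)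

theorem truncWeight_eq_zero {a N r : ℝ} (h : N * (1 - r) ≤ 1) : truncWeight a N r = 0 := by
  simp [truncWeight, cutoff_eq_zero h]

theorem contDiff_truncWeight {a N : ℝ} (hN : 0 < N) : ContDiff ℝ ∞ (truncWeight a N) := by
  rw [contDiff_iff_contDiffAt]
  intro r
  rcases lt_or_ge r 1 with h | h
  · have h1 : ContDiffAt ℝ ∞ (fun r : ℝ => (1 - r) ^ a) r :=
      (contDiffAt_const.sub contDiffAt_id).rpow_const_of_ne (by simpa using (sub_pos.2 h).ne')
    exact h1.mul ((contDiff_cutoff N).comp (contDiff_const.sub contDiff_id)).contDiffAt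
  · have : truncWeight a N =ᶠ[𝓝 r] fun _ => 0 := by
      have hc : ContinuousAt (fun r : ℝ => N * (1 - r)) r := by fun_prop
      filter_upwards [hc.eventually_lt_const (u := 1) (by nlinarith)] with t ht
      exact truncWeight_eq_zero ht.le
    exact contDiffAt_const.congr_of_eventuallyEq this

theorem deriv_truncWeight {a N r : ℝ} (hr : r < 1) :
    deriv (truncWeight a N) r =
      -(a * (1 - r) ^ (a - 1) * cutoff N (1 - r)) - (1 - r) ^ a * deriv (cutoff N) (1 - r) := by
  have h0 : HasDerivAt (fun r : ℝ => 1 - r) (-1) r := by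
    simpa using (hasDerivAt_id r).const_sub 1
  have h1 := h0.rpow_const (p := a) (Or.inl (sub_pos.2 hr).ne')
  have h2 := (((contDiff_cutoff N).differentiable (by simp)) (1 - r)).hasDerivAt.comp r h0
  have := (h1.mul h2).deriv
  rw [show truncWeight a N = (fun r : ℝ => (1 - r) ^ a) * (cutoff N ∘ fun r => 1 - r) from rfl,
    this]
  simp only [Function.comp]
  ring

theorem contDiff_radialField {f : ℝ → ℝ} (hf : ContDiff ℝ ∞ f) (i : Fin 3) :
    ContDiff ℝ ∞ fun q : Config => q i * f (‖q‖ ^ 2) :=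
  (EuclideanSpace.proj (𝕜 := ℝ) i).contDiff.mul (hf.comp (contDiff_norm_sq ℝ))

theorem fderiv_radialField {f : ℝ → ℝ} (hf : ContDiff ℝ ∞ f) (i : Fin 3) (q : Config) :
    fderiv ℝ (fun q : Config => q i * f (‖q‖ ^ 2)) q (EuclideanSpace.single i 1) =
      f (‖q‖ ^ 2) + 2 * q i ^ 2 * deriv f (‖q‖ ^ 2) := by
  have h1 : HasFDerivAt (fun q : Config => q i) (EuclideanSpace.proj (𝕜 := ℝ) i) q :=
    (EuclideanSpace.proj (𝕜 := ℝ) i).hasFDerivAt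
  have h2 := ((hf.differentiable (by simp)) (‖q‖ ^ 2)).hasDerivAt.comp_hasFDerivAt q
    (hasStrictFDerivAt_norm_sq q).hasFDerivAt
  have h3 := (h1.mul h2).fderiv
  simp only [Function.comp_def] at h3
  erw [h3]
  simp [EuclideanSpace.inner_single_right]
  ring

theorem sum_fderiv_radialField {f : ℝ → ℝ} (hf : ContDiff ℝ ∞ f) (q : Config) :
    ∑ i : Fin 3, fderiv ℝ (fun q : Config => q i * f (‖q‖ ^ 2)) q (EuclideanSpace.single i 1) =
      3 * f (‖q‖ ^ 2) + 2 * ‖q‖ ^ 2 * deriv f (‖q‖ ^ 2) := by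
  simp only [fderiv_radialField hf]
  rw [Finset.sum_add_distrib, ← Finset.sum_mul, ← Finset.mul_sum, EuclideanSpace.real_norm_sq_eq]
  simp

theorem tsupport_truncated_subset {N : ℝ} (hN : 0 < N) {c : Config → ℝ}
    (h : ∀ q : Config, N * (1 - ‖q‖ ^ 2) ≤ 1 → c q = 0) :
    HasCompactSupport c ∧ tsupport c ⊆ Ω := by
  have hcl : IsClosed {q : Config | 1 ≤ N * (1 - ‖q‖ ^ 2)} := isClosed_le (by fun_prop) (by fun_prop)
  have hsub : tsupport c ⊆ {q : Config | 1 ≤ N * (1 - ‖q‖ ^ 2)} := by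
    refine closure_minimal (fun q hq => ?_) hcl
    by_contra hlt
    exact hq (h q (not_le.1 hlt).le)
  have hΩ : {q : Config | 1 ≤ N * (1 - ‖q‖ ^ 2)} ⊆ Ω := by
    intro q hq
    have h1 : 1 ≤ N * (1 - ‖q‖ ^ 2) := hq
    rw [Ω, mem_ball_zero_iff]
    by_contra hge
    nlinarith [norm_nonneg q, mul_nonneg hN.le (by nlinarith [norm_nonneg q] : 0 ≤ ‖q‖ ^ 2 - 1)]
  refine ⟨?_, hsub.trans hΩ⟩
  exact (isCompact_closedBall (0 : Config) 1).of_isClosed_subset (isClosed_tsupport c)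
    ((hsub.trans hΩ).trans Metric.ball_subset_closedBall)

/-- The divergence theorem for u² times the field q f(|q|²): the rule for u² is applied to each
component, and the components are summed. The vanishing of f near and beyond r = 1 makes the
components test functions in Ω. -/
theorem IsWeakGradient.integral_sq_mul_div {u : Config → ℝ} {G : Config → Config}
    (h : IsWeakGradient u G) (hu : ∀ k ⊆ Ω, IsCompact k → MemLp u 2 (volume.restrict k))
    (hG : ∀ k ⊆ Ω, IsCompact k → MemLp G 2 (volume.restrict k)) {f : ℝ → ℝ}
    (hf : ContDiff ℝ ∞ f) {N : ℝ} (hN : 0 < N) (hf0 : ∀ r, N * (1 - r) ≤ 1 → f r = 0) :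
    Integrable (fun q => u q ^ 2 * (3 * f (‖q‖ ^ 2) + 2 * ‖q‖ ^ 2 * deriv f (‖q‖ ^ 2)))
      (volume.restrict Ω) ∧
    ∫ q in Ω, u q ^ 2 * (3 * f (‖q‖ ^ 2) + 2 * ‖q‖ ^ 2 * deriv f (‖q‖ ^ 2)) =
      - ∫ q in Ω, 2 * (u q * inner ℝ q (G q)) * f (‖q‖ ^ 2) := by
  have hsupp : ∀ i : Fin 3, HasCompactSupport (fun q : Config => q i * f (‖q‖ ^ 2)) ∧
      tsupport (fun q : Config => q i * f (‖q‖ ^ 2)) ⊆ Ω := fun i =>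
    tsupport_truncated_subset hN fun q hq => by rw [hf0 _ hq, mul_zero]
  have intc : ∀ {v c : Config → ℝ}, (∀ k ⊆ Ω, IsCompact k → Integrable v (volume.restrict k)) →
      Continuous c → HasCompactSupport c → tsupport c ⊆ Ω →
      Integrable (fun q => v q * c q) (volume.restrict Ω) := by
    intro v c hv hc hcs hcΩ
    have hi : IntegrableOn (fun q => v q * c q) (tsupport c) :=
      IntegrableOn.mul_continuousOn (hv _ hcΩ hcs) hc.continuousOn hcs
    refine ((integrableOn_iff_integrable_of_support_subset fun q hq => ?_).1 hi).integrableOn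
    exact subset_tsupport c fun h0 => hq (by simp [h0])
  have hu2 : ∀ k ⊆ Ω, IsCompact k → Integrable (fun q => u q ^ 2) (volume.restrict k) :=
    fun k hk hkc => (hu k hk hkc).integrable_sq
  have huG : ∀ i : Fin 3, ∀ k ⊆ Ω, IsCompact k →
      Integrable (fun q => 2 * (u q * G q i)) (volume.restrict k) := fun i k hk hkc =>
    ((hu k hk hkc).integrable_mul
      ((EuclideanSpace.proj (𝕜 := ℝ) i).comp_memLp' (hG k hk hkc))).const_mul 2
  have i1 : ∀ i : Fin 3, Integrable (fun q => u q ^ 2 *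
      fderiv ℝ (fun q : Config => q i * f (‖q‖ ^ 2)) q (EuclideanSpace.single i 1))
      (volume.restrict Ω) := fun i =>
    intc hu2 (((contDiff_radialField hf i).continuous_fderiv (by simp)).clm_apply continuous_const)
      ((hsupp i).1.fderiv_apply ℝ _)
      ((tsupport_fderiv_apply_subset ℝ _).trans (hsupp i).2)
  have i2 : ∀ i : Fin 3, Integrable (fun q => 2 * (u q * G q i) * (q i * f (‖q‖ ^ 2)))
      (volume.restrict Ω) := fun i =>
    intc (huG i) (contDiff_radialField hf i).continuous (hsupp i).1 (hsupp i).2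
  have e1 : (fun q => u q ^ 2 * (3 * f (‖q‖ ^ 2) + 2 * ‖q‖ ^ 2 * deriv f (‖q‖ ^ 2))) =
      fun q => ∑ i : Fin 3, u q ^ 2 *
        fderiv ℝ (fun q : Config => q i * f (‖q‖ ^ 2)) q (EuclideanSpace.single i 1) := by
    ext q
    rw [← Finset.mul_sum, sum_fderiv_radialField hf]
  have e2 : (fun q => 2 * (u q * inner ℝ q (G q)) * f (‖q‖ ^ 2)) =
      fun q => ∑ i : Fin 3, 2 * (u q * G q i) * (q i * f (‖q‖ ^ 2)) := by
    ext q
    rw [PiLp.inner_apply, Fin.sum_univ_three, Fin.sum_univ_three]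
    simp only [RCLike.inner_apply, conj_trivial]
    ring
  rw [e1, e2]
  refine ⟨integrable_finsetSum _ fun i _ => i1 i, ?_⟩
  rw [integral_finsetSum _ fun i _ => i1 i, integral_finsetSum _ fun i _ => i2 i,
    ← Finset.sum_neg_distrib]
  exact Finset.sum_congr rfl fun i _ => h.integral_sq_mul_fderiv hu hG (contDiff_radialField hf i)
    (hsupp i).1 (hsupp i).2 i

/-! ### The weighted measure and Lebesgue measure on compact subsets -/

theorem one_sub_normSq_pos {q : Config} (hq : q ∈ Ω) : 0 < 1 - ‖q‖ ^ 2 := by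
  have : ‖q‖ < 1 := by simpa [Ω] using hq
  nlinarith [norm_nonneg q]

theorem ae_mem_Ω (s : ℝ) : ∀ᵐ q ∂weightMeasure s, q ∈ Ω :=
  (withDensity_absolutelyContinuous _ _).ae_le (ae_restrict_mem isOpen_Ω.measurableSet)

theorem integral_weightMeasure (s : ℝ) (f : Config → ℝ) :
    ∫ q, f q ∂weightMeasure s = ∫ q in Ω, f q * (1 - ‖q‖ ^ 2) ^ s := by
  simpa [ip] using ip_eq s f fun _ => 1

theorem integrable_weightMeasure_iff (s : ℝ) (f : Config → ℝ) :
    Integrable f (weightMeasure s) ↔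
      Integrable (fun q => f q * (1 - ‖q‖ ^ 2) ^ s) (volume.restrict Ω) := by
  unfold weightMeasure
  rw [integrable_withDensity_iff_integrable_smul' (by fun_prop) (by simp)]
  refine integrable_congr ?_
  filter_upwards [ae_restrict_mem isOpen_Ω.measurableSet] with q hq
  rw [ENNReal.toReal_ofReal (weight_pos (s := s) hq).le, smul_eq_mul, mul_comm]

theorem exists_restrict_le_smul_weightMeasure (s : ℝ) {k : Set Config} (hk : k ⊆ Ω)
    (hkc : IsCompact k) :
    ∃ c : ENNReal, c ≠ ⊤ ∧ volume.restrict k ≤ c • weightMeasure s := by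
  have hcont : ContinuousOn (fun q : Config => (1 - ‖q‖ ^ 2) ^ s) k :=
    ContinuousOn.rpow_const (by fun_prop) fun q hq => Or.inl (one_sub_normSq_pos (hk hq)).ne'
  obtain ⟨c, hc, hcb⟩ : ∃ c : ℝ, 0 < c ∧ ∀ q ∈ k, c ≤ (1 - ‖q‖ ^ 2) ^ s := by
    rcases k.eq_empty_or_nonempty with rfl | hne
    · exact ⟨1, one_pos, by simp⟩
    · obtain ⟨x, hx, hxm⟩ := hkc.exists_isMinOn hne hcont
      exact ⟨_, weight_pos (hk hx), fun q hq => hxm hq⟩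
  have h0 : ENNReal.ofReal c ≠ 0 := by simpa using hc
  have h1 : ENNReal.ofReal c • volume.restrict k ≤ weightMeasure s := by
    rw [weightMeasure, ← withDensity_const]
    calc (volume.restrict k).withDensity (fun _ => ENNReal.ofReal c)
        ≤ (volume.restrict k).withDensity (fun q => ENNReal.ofReal ((1 - ‖q‖ ^ 2) ^ s)) := by
          refine withDensity_mono ?_
          filter_upwards [ae_restrict_mem hkc.measurableSet] with q hq
          exact ENNReal.ofReal_le_ofReal (hcb q hq)
      _ ≤ _ := by
          rw [Measure.le_iff]
          intro t ht
          rw [withDensity_apply _ ht, withDensity_apply _ ht]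
          exact lintegral_mono' (Measure.restrict_mono_measure
            (Measure.restrict_mono_set _ hk) t) le_rfl
  refine ⟨(ENNReal.ofReal c)⁻¹, by simpa using hc, ?_⟩
  calc volume.restrict k = (ENNReal.ofReal c)⁻¹ • ENNReal.ofReal c • volume.restrict k := by
        rw [smul_smul, ENNReal.inv_mul_cancel h0 ENNReal.ofReal_ne_top, one_smul]
    _ ≤ _ := by gcongr

theorem memLp_restrict_of_memLp_weightMeasure {s : ℝ} {F : Type*} [NormedAddCommGroup F]
    {f : Config → F} (hf : MemLp f 2 (weightMeasure s)) :
    ∀ k ⊆ Ω, IsCompact k → MemLp f 2 (volume.restrict k) := fun _ hk hkc =>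
  let ⟨_, hc, hle⟩ := exists_restrict_le_smul_weightMeasure s hk hkc
  hf.of_measure_le_smul hc hle

/-! ### The truncated radial inequality and Hardy's inequality -/

variable {s : ℝ} {u : Config → ℝ} {G : Config → Config}

theorem integrable_mul_radial_cutoff (hu : MemLp u 2 (weightMeasure s))
    (hG : MemLp G 2 (weightMeasure s)) {N : ℝ} (hN : 0 ≤ N) :
    Integrable (fun q => u q * radial G q * cutoff N (1 - ‖q‖ ^ 2)) (weightMeasure s) := by
  have hm : AEStronglyMeasurable (fun q : Config => (1 - ‖q‖ ^ 2)⁻¹ ^ 1 * cutoff N (1 - ‖q‖ ^ 2))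
      (weightMeasure s) := by
    have : Measurable (cutoff N) := (contDiff_cutoff N).continuous.measurable
    exact (by fun_prop : Measurable _).aestronglyMeasurable
  have hqm : AEStronglyMeasurable (fun q => (inner ℝ q (G q) : ℝ)) (weightMeasure s) :=
    aestronglyMeasurable_id.inner hG.1
  have hq : MemLp (fun q => (inner ℝ q (G q) : ℝ)) 2 (weightMeasure s) := by
    refine hG.mono hqm ?_
    filter_upwards [ae_mem_Ω s] with q hq
    have h1 : ‖q‖ < 1 := by simpa [Ω] using hq
    calc ‖(inner ℝ q (G q) : ℝ)‖ ≤ ‖q‖ * ‖G q‖ := norm_inner_le_norm _ _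
      _ ≤ ‖G q‖ := mul_le_of_le_one_left (norm_nonneg _) h1.le
  have := (hu.integrable_mul hq).mul_bdd (c := N ^ 1) hm ?_
  · refine this.congr (Eventually.of_forall fun q => ?_)
    simp only [Pi.mul_apply, radial, div_eq_mul_inv, pow_one]
    ring
  · filter_upwards [ae_mem_Ω s] with q hq
    have hw := one_sub_normSq_pos hq
    rw [Real.norm_of_nonneg (mul_nonneg (pow_nonneg (inv_nonneg.2 hw.le) 1) (cutoff_nonneg _ _))]
    exact inv_pow_mul_cutoff_le hw hN 1

theorem integrable_sq_mul_cutoff (hu : MemLp u 2 (weightMeasure s)) {N : ℝ} (hN : 0 ≤ N) (j : ℕ) :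
    Integrable (fun q => u q ^ 2 * ((1 - ‖q‖ ^ 2)⁻¹ ^ j * cutoff N (1 - ‖q‖ ^ 2)))
      (weightMeasure s) := by
  have hm : AEStronglyMeasurable
      (fun q : Config => (1 - ‖q‖ ^ 2)⁻¹ ^ j * cutoff N (1 - ‖q‖ ^ 2)) (weightMeasure s) := by
    have : Measurable (cutoff N) := (contDiff_cutoff N).continuous.measurable
    exact (by fun_prop : Measurable _).aestronglyMeasurable
  refine hu.integrable_sq.mul_bdd (c := N ^ j) hm ?_
  filter_upwards [ae_mem_Ω s] with q hq
  have hw := one_sub_normSq_pos hq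
  rw [Real.norm_of_nonneg (mul_nonneg (pow_nonneg (inv_nonneg.2 hw.le) j) (cutoff_nonneg _ _))]
  exact inv_pow_mul_cutoff_le hw hN j

/-- Divergence theorem with f the truncation of w^(s-1); the exponent s - 1 accounts for the factor
1/w in `radial`. Replacing |q|² by 1 - w produces the coefficients 2(s-1) and 2s+1, and the term
containing the derivative of the cutoff is dropped. -/
theorem IsWeakGradient.integral_sq_mul_cutoff_le (h : IsWeakGradient u G)
    (hu : MemLp u 2 (weightMeasure s)) (hG : MemLp G 2 (weightMeasure s)) {N : ℝ} (hN : 0 < N) :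
    ∫ q, (2 * (s - 1) * (u q ^ 2 * ((1 - ‖q‖ ^ 2)⁻¹ ^ 2 * cutoff N (1 - ‖q‖ ^ 2))) -
      (2 * s + 1) * (u q ^ 2 * ((1 - ‖q‖ ^ 2)⁻¹ ^ 1 * cutoff N (1 - ‖q‖ ^ 2)))) ∂weightMeasure s ≤
      ∫ q, 2 * (u q * radial G q * cutoff N (1 - ‖q‖ ^ 2)) ∂weightMeasure s := by
  obtain ⟨hi, he⟩ := h.integral_sq_mul_div (memLp_restrict_of_memLp_weightMeasure hu)
    (memLp_restrict_of_memLp_weightMeasure hG) (contDiff_truncWeight (a := s - 1) hN) hN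
    fun r hr => truncWeight_eq_zero hr
  have hi' := ((integrable_sq_mul_cutoff hu hN.le 2).const_mul (2 * (s - 1))).sub
    ((integrable_sq_mul_cutoff hu hN.le 1).const_mul (2 * s + 1))
  have hpow : ∀ {q : Config}, q ∈ Ω → (1 - ‖q‖ ^ 2) ^ (s - 1) =
      (1 - ‖q‖ ^ 2)⁻¹ * (1 - ‖q‖ ^ 2) ^ s := fun hq => by
    rw [Real.rpow_sub_one (one_sub_normSq_pos hq).ne', div_eq_inv_mul]
  have hR : ∫ q, 2 * (u q * radial G q * cutoff N (1 - ‖q‖ ^ 2)) ∂weightMeasure s =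
      ∫ q in Ω, 2 * (u q * inner ℝ q (G q)) * truncWeight (s - 1) N (‖q‖ ^ 2) := by
    rw [integral_weightMeasure]
    refine setIntegral_congr_fun isOpen_Ω.measurableSet fun q hq => ?_
    simp only [truncWeight, radial, hpow hq, div_eq_mul_inv]
    ring
  rw [hR, ← neg_neg (∫ q in Ω, 2 * (u q * inner ℝ q (G q)) * _), ← he, integral_weightMeasure,
    ← integral_neg]
  refine setIntegral_mono_on ((integrable_weightMeasure_iff s _).1 hi') hi.neg
    isOpen_Ω.measurableSet fun q hq => ?_
  have hw := one_sub_normSq_pos hq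
  have hd := deriv_cutoff_nonneg hN.le (1 - ‖q‖ ^ 2)
  have hws := weight_pos (s := s) hq
  rw [deriv_truncWeight (by linarith), Real.rpow_sub_one hw.ne', truncWeight, hpow hq,
    div_eq_inv_mul]
  -- This is exactly the dropped term, nonnegative because the cutoff is nondecreasing in w.
  have hnn : 0 ≤ 2 * u q ^ 2 * ‖q‖ ^ 2 *
      ((1 - ‖q‖ ^ 2)⁻¹ * (1 - ‖q‖ ^ 2) ^ s * deriv (cutoff N) (1 - ‖q‖ ^ 2)) := by positivity
  refine le_of_sub_nonneg (hnn.trans_eq ?_)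
  have hq2 : ‖q‖ ^ 2 = 1 - (1 - ‖q‖ ^ 2) := by ring
  generalize 1 - ‖q‖ ^ 2 = w at *
  rw [hq2]
  field_simp
  ring

/-- Half of the leading term 2(s-1) u² w⁻² absorbs the two lower order terms by Young's inequality.
The bound does not depend on N. -/
theorem IsWeakGradient.integral_sq_mul_inv_sq_cutoff_le (h : IsWeakGradient u G) (hs : 1 < s)
    (hu : MemLp u 2 (weightMeasure s)) (hG : MemLp G 2 (weightMeasure s)) {N : ℝ} (hN : 0 < N) :
    ∫ q, u q ^ 2 * ((1 - ‖q‖ ^ 2)⁻¹ ^ 2 * cutoff N (1 - ‖q‖ ^ 2)) ∂weightMeasure s ≤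
      (2 * s + 1) ^ 2 / (s - 1) ^ 2 * ∫ q, u q ^ 2 ∂weightMeasure s +
      2 / (s - 1) ^ 2 * ∫ q, ‖G q‖ ^ 2 ∂weightMeasure s := by
  have hs' : 0 < s - 1 := sub_pos.2 hs
  have key := h.integral_sq_mul_cutoff_le hu hG hN
  have i2 := integrable_sq_mul_cutoff hu hN.le 2
  have i1 := integrable_sq_mul_cutoff hu hN.le 1
  have ir := integrable_mul_radial_cutoff hu hG hN.le
  have iG : Integrable (fun q => ‖G q‖ ^ 2) (weightMeasure s) := hG.integrable_norm_pow two_ne_zero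
  have iu := hu.integrable_sq
  have hpt : ∫ q, (s - 1) * (u q ^ 2 * ((1 - ‖q‖ ^ 2)⁻¹ ^ 2 * cutoff N (1 - ‖q‖ ^ 2)))
        ∂weightMeasure s ≤
      ∫ q, ((2 * (s - 1) * (u q ^ 2 * ((1 - ‖q‖ ^ 2)⁻¹ ^ 2 * cutoff N (1 - ‖q‖ ^ 2))) -
      (2 * s + 1) * (u q ^ 2 * ((1 - ‖q‖ ^ 2)⁻¹ ^ 1 * cutoff N (1 - ‖q‖ ^ 2)))) -
      2 * (u q * radial G q * cutoff N (1 - ‖q‖ ^ 2)) +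
      ((2 * s + 1) ^ 2 / (s - 1) * u q ^ 2 + 2 / (s - 1) * ‖G q‖ ^ 2)) ∂weightMeasure s := by
    refine integral_mono_ae (i2.const_mul _) ((((i2.const_mul _).sub (i1.const_mul _)).sub
      (ir.const_mul _)).add ((iu.const_mul _).add (iG.const_mul _))) ?_
    filter_upwards [ae_mem_Ω s] with q hq
    have hw := one_sub_normSq_pos hq
    have h0 := cutoff_nonneg N (1 - ‖q‖ ^ 2)
    have h1 := cutoff_le_one N (1 - ‖q‖ ^ 2)
    have hin : (inner ℝ q (G q) : ℝ) ≤ 1 * ‖G q‖ ∧ -(1 * ‖G q‖) ≤ (inner ℝ q (G q) : ℝ) := by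
      have hq1 : ‖q‖ ≤ 1 := by nlinarith [norm_nonneg q]
      have := (abs_real_inner_le_norm q (G q)).trans
        (mul_le_mul_of_nonneg_right hq1 (norm_nonneg (G q)))
      exact ⟨(abs_le.1 this).2, (abs_le.1 this).1⟩
    have hin2 : (inner ℝ q (G q) : ℝ) ^ 2 ≤ ‖G q‖ ^ 2 := by nlinarith
    simp only [radial, div_eq_mul_inv (inner ℝ q (G q)), pow_one]
    generalize cutoff N (1 - ‖q‖ ^ 2) = η at *
    generalize (inner ℝ q (G q) : ℝ) = p at *
    generalize ‖G q‖ = g at *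
    generalize (1 - ‖q‖ ^ 2)⁻¹ = v at *
    generalize u q = a at *
    generalize s - 1 = c at *
    have e1 : 0 ≤ η * (c * (a * v) ^ 2 - (2 * s + 1) * (a * v) * a - 2 * (a * v) * p +
        (2 * s + 1) ^ 2 / c * a ^ 2 + 2 / c * p ^ 2) := by
      refine mul_nonneg h0 ?_
      -- Young's inequality as a sum of squares: divided by 2c, with c = s - 1, it is the bracket in
      -- `e1`.
      have : 0 ≤ (c * (a * v) - (2 * s + 1) * a) ^ 2 + (c * (a * v) - 2 * p) ^ 2 +
        (2 * s + 1) ^ 2 * a ^ 2 := by positivity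
      refine (div_nonneg this (by positivity : 0 ≤ 2 * c)).trans_eq ?_
      field_simp
      ring
    have e2 : η * ((2 * s + 1) ^ 2 / c * a ^ 2 + 2 / c * p ^ 2) ≤
        (2 * s + 1) ^ 2 / c * a ^ 2 + 2 / c * g ^ 2 := by
      have : 2 / c * p ^ 2 ≤ 2 / c * g ^ 2 := by gcongr
      have h3 : 0 ≤ (2 * s + 1) ^ 2 / c * a ^ 2 + 2 / c * p ^ 2 := by positivity
      nlinarith
    linarith
  have iA : Integrable (fun q =>
      2 * (s - 1) * (u q ^ 2 * ((1 - ‖q‖ ^ 2)⁻¹ ^ 2 * cutoff N (1 - ‖q‖ ^ 2))) -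
      (2 * s + 1) * (u q ^ 2 * ((1 - ‖q‖ ^ 2)⁻¹ ^ 1 * cutoff N (1 - ‖q‖ ^ 2))))
      (weightMeasure s) := (i2.const_mul _).sub (i1.const_mul _)
  have iB : Integrable (fun q => (2 * s + 1) ^ 2 / (s - 1) * u q ^ 2 + 2 / (s - 1) * ‖G q‖ ^ 2)
      (weightMeasure s) := (iu.const_mul _).add (iG.const_mul _)
  have iR : Integrable (fun q => 2 * (u q * radial G q * cutoff N (1 - ‖q‖ ^ 2)))
      (weightMeasure s) := ir.const_mul 2
  have iC : Integrable (fun q =>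
      2 * (s - 1) * (u q ^ 2 * ((1 - ‖q‖ ^ 2)⁻¹ ^ 2 * cutoff N (1 - ‖q‖ ^ 2))) -
      (2 * s + 1) * (u q ^ 2 * ((1 - ‖q‖ ^ 2)⁻¹ ^ 1 * cutoff N (1 - ‖q‖ ^ 2))) -
      2 * (u q * radial G q * cutoff N (1 - ‖q‖ ^ 2))) (weightMeasure s) := iA.sub iR
  rw [integral_add iC iB, integral_sub iA iR, integral_add (iu.const_mul _) (iG.const_mul _),
    integral_const_mul, integral_const_mul ((2 * s + 1) ^ 2 / (s - 1)),
    integral_const_mul (2 / (s - 1))] at hpt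
  have hpt' := hpt.trans (add_le_of_nonpos_left (sub_nonpos.2 key))
  rw [← le_div_iff₀' hs'] at hpt'
  refine hpt'.trans_eq ?_
  field_simp

/-- Hardy's inequality for the weight `(1 - |q|²) ^ s` with `s > 1`. -/
theorem IsWeakGradient.integrable_sq_mul_inv_sq (h : IsWeakGradient u G) (hs : 1 < s)
    (hu : MemLp u 2 (weightMeasure s)) (hG : MemLp G 2 (weightMeasure s)) :
    Integrable (fun q => u q ^ 2 * (1 - ‖q‖ ^ 2)⁻¹ ^ 2) (weightMeasure s) ∧
    ∫ q, u q ^ 2 * (1 - ‖q‖ ^ 2)⁻¹ ^ 2 ∂weightMeasure s ≤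
      (2 * s + 1) ^ 2 / (s - 1) ^ 2 * ∫ q, u q ^ 2 ∂weightMeasure s +
      2 / (s - 1) ^ 2 * ∫ q, ‖G q‖ ^ 2 ∂weightMeasure s := by
  set C := (2 * s + 1) ^ 2 / (s - 1) ^ 2 * ∫ q, u q ^ 2 ∂weightMeasure s +
      2 / (s - 1) ^ 2 * ∫ q, ‖G q‖ ^ 2 ∂weightMeasure s
  let F : ℕ → Config → ℝ := fun n q =>
    u q ^ 2 * ((1 - ‖q‖ ^ 2)⁻¹ ^ 2 * cutoff (n + 1 : ℕ) (1 - ‖q‖ ^ 2))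
  have hF0 : ∀ n q, 0 ≤ F n q := fun n q =>
    mul_nonneg (sq_nonneg _) (mul_nonneg (sq_nonneg _) (cutoff_nonneg _ _))
  have hFi : ∀ n, Integrable (F n) (weightMeasure s) := fun n =>
    integrable_sq_mul_cutoff hu (Nat.cast_nonneg _) 2
  have hFl : ∀ᵐ q ∂weightMeasure s,
      Tendsto (fun n => F n q) atTop (𝓝 (u q ^ 2 * (1 - ‖q‖ ^ 2)⁻¹ ^ 2)) := by
    filter_upwards [ae_mem_Ω s] with q hq
    have := (tendsto_cutoff (one_sub_normSq_pos hq)).comp (tendsto_add_atTop_nat 1)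
    simpa [F, -inv_pow] using (this.const_mul ((1 - ‖q‖ ^ 2)⁻¹ ^ 2)).const_mul (u q ^ 2)
  -- Fatou's lemma removes the cutoff; integrability of the limit is a conclusion here, so the bound
  -- is taken for the lower integral.
  have hle : ∫⁻ q, ENNReal.ofReal (u q ^ 2 * (1 - ‖q‖ ^ 2)⁻¹ ^ 2) ∂weightMeasure s ≤
      ENNReal.ofReal C := by
    calc _ = ∫⁻ q, liminf (fun n => ENNReal.ofReal (F n q)) atTop ∂weightMeasure s := by
          refine lintegral_congr_ae ?_
          filter_upwards [hFl] with q hq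
          exact ((ENNReal.continuous_ofReal.tendsto _).comp hq).liminf_eq.symm
      _ ≤ liminf (fun n => ∫⁻ q, ENNReal.ofReal (F n q) ∂weightMeasure s) atTop :=
          lintegral_liminf_le' fun n => (hFi n).1.aemeasurable.ennreal_ofReal
      _ ≤ liminf (fun _ : ℕ => ENNReal.ofReal C) atTop := by
          refine liminf_le_liminf (Eventually.of_forall fun n => ?_)
          rw [← ofReal_integral_eq_lintegral_ofReal (hFi n) (Eventually.of_forall (hF0 n))]
          exact ENNReal.ofReal_le_ofReal
            (h.integral_sq_mul_inv_sq_cutoff_le hs hu hG (Nat.cast_pos.2 n.succ_pos))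
      _ = _ := liminf_const _
  have hm : AEStronglyMeasurable (fun q => u q ^ 2 * (1 - ‖q‖ ^ 2)⁻¹ ^ 2) (weightMeasure s) :=
    aestronglyMeasurable_of_tendsto_ae _ (fun n => (hFi n).1) hFl
  have h0 : 0 ≤ᵐ[weightMeasure s] fun q => u q ^ 2 * (1 - ‖q‖ ^ 2)⁻¹ ^ 2 :=
    Eventually.of_forall fun q => mul_nonneg (sq_nonneg _) (sq_nonneg _)
  refine ⟨⟨hm, ?_⟩, ?_⟩
  · rw [hasFiniteIntegral_iff_ofReal h0]
    exact hle.trans_lt ENNReal.ofReal_lt_top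
  · rw [integral_eq_lintegral_of_nonneg_ae h0 hm]
    refine ENNReal.toReal_le_of_le_ofReal ?_ hle
    have : 0 ≤ ∫ q, u q ^ 2 ∂weightMeasure s := integral_nonneg fun q => sq_nonneg _
    have : 0 ≤ ∫ q, ‖G q‖ ^ 2 ∂weightMeasure s := integral_nonneg fun q => sq_nonneg _
    positivity

/-! ### The potential term: convergence and lower bound -/

theorem integrable_mul_radial (hu : MemLp (fun q => u q * (1 - ‖q‖ ^ 2)⁻¹) 2 (weightMeasure s))
    (hG : MemLp G 2 (weightMeasure s)) :
    Integrable (fun q => u q * radial G q) (weightMeasure s) := by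
  have hq : MemLp (fun q => (inner ℝ q (G q) : ℝ)) 2 (weightMeasure s) := by
    refine hG.mono (aestronglyMeasurable_id.inner hG.1) ?_
    filter_upwards [ae_mem_Ω s] with q hq
    have h1 : ‖q‖ < 1 := by simpa [Ω] using hq
    calc ‖(inner ℝ q (G q) : ℝ)‖ ≤ ‖q‖ * ‖G q‖ := norm_inner_le_norm _ _
      _ ≤ ‖G q‖ := mul_le_of_le_one_left (norm_nonneg _) h1.le
  refine (hu.integrable_mul hq).congr (Eventually.of_forall fun q => ?_)
  simp only [Pi.mul_apply, radial, div_eq_mul_inv]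
  ring

theorem IsWeakGradient.memLp_mul_inv (h : IsWeakGradient u G) (hs : 1 < s)
    (hu : MemLp u 2 (weightMeasure s)) (hG : MemLp G 2 (weightMeasure s)) :
    MemLp (fun q => u q * (1 - ‖q‖ ^ 2)⁻¹) 2 (weightMeasure s) := by
  have hm : AEStronglyMeasurable (fun q : Config => (1 - ‖q‖ ^ 2)⁻¹) (weightMeasure s) :=
    (by fun_prop : Measurable _).aestronglyMeasurable
  refine (memLp_two_iff_integrable_sq (hu.1.mul hm)).2 ?_
  simpa only [Pi.mul_apply, mul_pow] using (h.integrable_sq_mul_inv_sq hs hu hG).1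

/-- The minimum over v of 2(s-1)v² - (2s+1)v is -(2s+1)²/(8(s-1)), which equals -2γ(s); applied with
v = w⁻¹ in the truncated inequality. -/
theorem IsWeakGradient.neg_gammaThreshold_mul_le (h : IsWeakGradient u G) (hs : 1 < s)
    (hu : MemLp u 2 (weightMeasure s)) (hG : MemLp G 2 (weightMeasure s)) :
    -(gammaThreshold s * ∫ q, u q ^ 2 ∂weightMeasure s) ≤
      ∫ q, u q * radial G q ∂weightMeasure s := by
  have hs' : 0 < s - 1 := sub_pos.2 hs
  have hi := integrable_mul_radial (h.memLp_mul_inv hs hu hG) hG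
  have iu := hu.integrable_sq
  have hγ : gammaThreshold s = (2 * s + 1) ^ 2 / (16 * (s - 1)) := by
    rw [gammaThreshold]; field_simp; ring
  have hγ0 : 0 ≤ gammaThreshold s := by rw [hγ]; positivity
  have hn : ∀ n : ℕ, -(gammaThreshold s * ∫ q, u q ^ 2 ∂weightMeasure s) ≤
      ∫ q, u q * radial G q * cutoff (n + 1 : ℕ) (1 - ‖q‖ ^ 2) ∂weightMeasure s := by
    intro n
    have hN : (0 : ℝ) < (n + 1 : ℕ) := Nat.cast_pos.2 n.succ_pos
    have key := h.integral_sq_mul_cutoff_le hu hG hN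
    have i2 := integrable_sq_mul_cutoff hu hN.le 2
    have i1 := integrable_sq_mul_cutoff hu hN.le 1
    rw [integral_const_mul] at key
    have : ∫ q, -(2 * gammaThreshold s) * u q ^ 2 ∂weightMeasure s ≤ _ :=
      (integral_mono_ae (iu.const_mul _) ((i2.const_mul _).sub (i1.const_mul _)) ?_).trans key
    · rw [integral_const_mul] at this
      linarith
    · filter_upwards with q
      have h0 := cutoff_nonneg (n + 1 : ℕ) (1 - ‖q‖ ^ 2)
      have h1 := cutoff_le_one (n + 1 : ℕ) (1 - ‖q‖ ^ 2)
      simp only [Pi.sub_apply, pow_one]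
      generalize cutoff (n + 1 : ℕ) (1 - ‖q‖ ^ 2) = η at *
      generalize (1 - ‖q‖ ^ 2)⁻¹ = v
      have e1 : 0 ≤ u q ^ 2 * η *
          (2 * (s - 1) * v ^ 2 - (2 * s + 1) * v + 2 * gammaThreshold s) := by
        refine mul_nonneg (by positivity) ?_
        have : 0 ≤ (4 * (s - 1) * v - (2 * s + 1)) ^ 2 / (8 * (s - 1)) := by positivity
        refine this.trans_eq ?_
        rw [hγ]; field_simp; ring
      have e2 : 0 ≤ gammaThreshold s * u q ^ 2 * (1 - η) :=
        mul_nonneg (by positivity) (sub_nonneg.2 h1)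
      linarith
  -- Hardy's inequality has made u · `radial G` integrable, so it dominates its own truncations.
  have hlim : Tendsto (fun n : ℕ =>
      ∫ q, u q * radial G q * cutoff (n + 1 : ℕ) (1 - ‖q‖ ^ 2) ∂weightMeasure s) atTop
      (𝓝 (∫ q, u q * radial G q ∂weightMeasure s)) := by
    refine tendsto_integral_of_dominated_convergence (fun q => ‖u q * radial G q‖)
      (fun n => (integrable_mul_radial_cutoff hu hG (Nat.cast_nonneg _)).1) hi.norm
      (fun n => Eventually.of_forall fun q => ?_) ?_
    · rw [norm_mul, Real.norm_of_nonneg (cutoff_nonneg _ _)]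
      exact mul_le_of_le_one_right (norm_nonneg _) (cutoff_le_one _ _)
    · filter_upwards [ae_mem_Ω s] with q hq
      have := (tendsto_cutoff (one_sub_normSq_pos hq)).comp (tendsto_add_atTop_nat 1)
      simpa using this.const_mul (u q * radial G q)
  exact ge_of_tendsto' hlim hn

/-! ### The Hilbert space of functions with their weak gradients -/

theorem isFiniteMeasure_weightMeasure {s : ℝ} (hs : 0 ≤ s) : IsFiniteMeasure (weightMeasure s) := by
  refine isFiniteMeasure_withDensity (ne_of_lt ?_)
  calc ∫⁻ q in Ω, ENNReal.ofReal ((1 - ‖q‖ ^ 2) ^ s) ≤ ∫⁻ q in Ω, 1 := by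
        refine setLIntegral_mono measurable_const fun q hq => ENNReal.ofReal_le_one.2 ?_
        exact Real.rpow_le_one (one_sub_normSq_pos hq).le (by nlinarith [norm_nonneg q]) hs
    _ < ⊤ := by simp [Ω]

/-- The representer is w^(-s) c: the weight is smooth and positive on the support of c, so this is
continuous with compact support and turns Lebesgue pairings into weighted inner products. -/
theorem exists_inner_eq_setIntegral {s : ℝ} (hs : 0 ≤ s) {F : Type*} [NormedAddCommGroup F]
    [InnerProductSpace ℝ F] {c : Config → F} (hc : Continuous c) (hcs : HasCompactSupport c)
    (hcΩ : tsupport c ⊆ Ω) :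
    ∃ ψ : Lp F 2 (weightMeasure s), ∀ v : Lp F 2 (weightMeasure s),
      inner ℝ ψ v = ∫ q in Ω, (inner ℝ (c q) (v q) : ℝ) := by
  have := isFiniteMeasure_weightMeasure hs
  have hsub : Function.support (fun q => (1 - ‖q‖ ^ 2) ^ (-s) • c q) ⊆ Function.support c :=
    Function.support_smul_subset_right _ _
  have hcont : Continuous fun q => (1 - ‖q‖ ^ 2) ^ (-s) • c q := by
    refine ContinuousOn.continuous_of_tsupport_subset (s := Ω) (ContinuousOn.smul ?_ hc.continuousOn)
      isOpen_Ω ((closure_mono hsub).trans hcΩ)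
    exact ContinuousOn.rpow_const (by fun_prop) fun q hq => Or.inl (one_sub_normSq_pos hq).ne'
  have hm : MemLp (fun q => (1 - ‖q‖ ^ 2) ^ (-s) • c q) 2 (weightMeasure s) :=
    hcont.memLp_of_hasCompactSupport (hcs.mono hsub)
  refine ⟨hm.toLp _, fun v => ?_⟩
  rw [L2.inner_def]
  have e : ∫ q, (inner ℝ (hm.toLp _ q) (v q) : ℝ) ∂weightMeasure s =
      ∫ q, (inner ℝ ((1 - ‖q‖ ^ 2) ^ (-s) • c q) (v q) : ℝ) ∂weightMeasure s := by
    refine integral_congr_ae ?_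
    filter_upwards [hm.coeFn_toLp] with q hq
    rw [hq]
  rw [e, integral_weightMeasure]
  refine setIntegral_congr_fun isOpen_Ω.measurableSet fun q hq => ?_
  simp only [real_inner_smul_left, Real.rpow_neg (one_sub_normSq_pos hq).le]
  have := (weight_pos (s := s) hq).ne'
  field_simp

/-- Each test function and index imposes orthogonality to one fixed vector, so the graph of the weak
gradient is an orthogonal complement. -/
theorem exists_submodule_mem_iff_isWeakGradient {s : ℝ} (hs : 0 ≤ s) :
    ∃ W : Submodule ℝ (WithLp 2 (L2 s × L2Vec s)), IsClosed (W : Set (WithLp 2 (L2 s × L2Vec s))) ∧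
      ∀ x, x ∈ W ↔ IsWeakGradient x.fst x.snd := by
  let I := {p : (Config → ℝ) × Fin 3 //
    ContDiff ℝ ∞ p.1 ∧ HasCompactSupport p.1 ∧ tsupport p.1 ⊆ Ω}
  have H : ∀ p : I, ∃ ψ : WithLp 2 (L2 s × L2Vec s), ∀ x : WithLp 2 (L2 s × L2Vec s),
      inner ℝ ψ x = (∫ q in Ω, x.fst q * fderiv ℝ p.1.1 q (EuclideanSpace.single p.1.2 1)) +
        ∫ q in Ω, x.snd q p.1.2 * p.1.1 q := by
    rintro ⟨⟨φ, i⟩, hφ, hφc, hφΩ⟩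
    obtain ⟨ψ₁, h₁⟩ := exists_inner_eq_setIntegral hs
      (c := fun q => fderiv ℝ φ q (EuclideanSpace.single i 1))
      ((hφ.continuous_fderiv (by simp)).clm_apply continuous_const) (hφc.fderiv_apply ℝ _)
      ((tsupport_fderiv_apply_subset ℝ _).trans hφΩ)
    have hsub : Function.support (fun q => φ q • (EuclideanSpace.single i 1 : Config)) ⊆
      Function.support φ := fun q hq h0 => hq (by simp [h0])
    obtain ⟨ψ₂, h₂⟩ := exists_inner_eq_setIntegral hs
      (c := fun q => φ q • (EuclideanSpace.single i 1 : Config))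
      (hφ.continuous.smul continuous_const) (hφc.mono hsub) ((closure_mono hsub).trans hφΩ)
    refine ⟨WithLp.toLp 2 (ψ₁, ψ₂), fun x => ?_⟩
    rw [WithLp.prod_inner_apply]
    refine congrArg₂ (· + ·) ((h₁ x.fst).trans ?_) ((h₂ x.snd).trans ?_)
    · rfl
    · refine integral_congr_ae (Eventually.of_forall fun q => ?_)
      simp [real_inner_smul_left, EuclideanSpace.inner_single_left, mul_comm]
  choose Ψ hΨ using H
  refine ⟨(Submodule.span ℝ (Set.range Ψ))ᗮ, Submodule.isClosed_orthogonal _, fun x => ?_⟩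
  have hmem : x ∈ (Submodule.span ℝ (Set.range Ψ))ᗮ ↔ ∀ p, inner ℝ (Ψ p) x = 0 := by
    rw [← Submodule.span_singleton_le_iff_mem, ← Submodule.isOrtho_iff_le, Submodule.isOrtho_comm,
      Submodule.isOrtho_span]
    simp
  rw [hmem]
  constructor
  · intro h φ hφ hφc hφΩ i
    have := h ⟨(φ, i), hφ, hφc, hφΩ⟩
    rw [hΨ] at this
    exact eq_neg_of_add_eq_zero_left this
  · rintro h ⟨⟨φ, i⟩, hφ, hφc, hφΩ⟩
    rw [hΨ]
    exact eq_neg_iff_add_eq_zero.1 (h φ hφ hφc hφΩ i)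

/-- Lax–Milgram: the coercive form is an isomorphism followed by the inner product, and Riesz
represents ℓ. -/
theorem existsUnique_of_isCoercive {V : Type*} [NormedAddCommGroup V] [InnerProductSpace ℝ V]
    [CompleteSpace V] {B : V →L[ℝ] V →L[ℝ] ℝ} (hB : IsCoercive B) (ℓ : V →L[ℝ] ℝ) :
    ∃! v, ∀ w, B v w = ℓ w := by
  set e := hB.continuousLinearEquivOfBilin
  set f := (InnerProductSpace.toDual ℝ V).symm ℓ
  have hf : ∀ w, inner ℝ f w = ℓ w := fun w => InnerProductSpace.toDual_symm_apply
  refine ⟨e.symm f, fun w => ?_, fun v hv => ?_⟩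
  · rw [← hB.continuousLinearEquivOfBilin_apply, ← hf]
    congr 1
    exact e.apply_symm_apply f
  · rw [ContinuousLinearEquiv.eq_symm_apply]
    refine ext_inner_right ℝ fun w => ?_
    rw [hf, ← hv, hB.continuousLinearEquivOfBilin_apply]

/-! ### The terms of the scheme as bounded operators and inner products -/

theorem ip_eq_inner (f g : L2 s) : ip s f g = inner ℝ f g := by
  rw [L2.inner_def, ip]
  simp [mul_comm]

theorem ipVec_eq_inner (F G : L2Vec s) : ipVec s F G = inner ℝ F G := by
  rw [L2.inner_def, ipVec]

theorem norm_sq_eq_integral {F : Type*} [NormedAddCommGroup F] [InnerProductSpace ℝ F]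
    (f : Lp F 2 (weightMeasure s)) : ‖f‖ ^ 2 = ∫ q, ‖f q‖ ^ 2 ∂weightMeasure s := by
  rw [← real_inner_self_eq_norm_sq, L2.inner_def]
  simp

/-- The vector field `q u(q) / (1 - |q|²)`, which pairs with `∇g` to the potential term. -/
def radialField (u : Config → ℝ) (q : Config) : Config := (u q * (1 - ‖q‖ ^ 2)⁻¹) • q

theorem inner_radialField (u : Config → ℝ) (G : Config → Config) (q : Config) :
    inner ℝ (radialField u q) (G q) = u q * radial G q := by
  rw [radialField, real_inner_smul_left, radial, div_eq_mul_inv]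
  ring

theorem norm_radialField_le (u : Config → ℝ) :
    ∀ᵐ q ∂weightMeasure s, ‖radialField u q‖ ≤ ‖u q * (1 - ‖q‖ ^ 2)⁻¹‖ := by
  filter_upwards [ae_mem_Ω s] with q hq
  have h1 : ‖q‖ < 1 := by simpa [Ω] using hq
  rw [radialField, norm_smul]
  exact mul_le_of_le_one_right (norm_nonneg _) h1.le

theorem IsWeakGradient.memLp_radialField {u : Config → ℝ} {G : Config → Config}
    (h : IsWeakGradient u G) (hs : 1 < s)
    (hu : MemLp u 2 (weightMeasure s)) (hG : MemLp G 2 (weightMeasure s)) :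
    MemLp (radialField u) 2 (weightMeasure s) := by
  have hm := h.memLp_mul_inv hs hu hG
  exact hm.mono (hm.1.smul aestronglyMeasurable_id) (norm_radialField_le u)

/-- Hardy's inequality read as boundedness of u ↦ q u / w from W to L²_s, so that the potential term
becomes a bounded bilinear form on W. -/
theorem exists_radialField_clm (hs : 1 < s) {W : Submodule ℝ (WithLp 2 (L2 s × L2Vec s))}
    (hW : ∀ x ∈ W, IsWeakGradient x.fst x.snd) :
    ∃ T : W →L[ℝ] L2Vec s, ∀ v : W, T v =ᵐ[weightMeasure s] radialField v.1.fst := by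
  have hm : ∀ v : W, MemLp (radialField v.1.fst) 2 (weightMeasure s) := fun v =>
    (hW v v.2).memLp_radialField hs (Lp.memLp _) (Lp.memLp _)
  let T₀ : W →ₗ[ℝ] L2Vec s :=
    { toFun := fun v => (hm v).toLp _
      map_add' := fun v w => by
        rw [← MemLp.toLp_add]
        refine MemLp.toLp_congr _ _ ?_
        filter_upwards [Lp.coeFn_add v.1.fst w.1.fst] with q hq
        have : (v + w).1.fst q = v.1.fst q + w.1.fst q := hq
        simp only [Pi.add_apply, radialField, this, ← add_smul, add_mul]
      map_smul' := fun c v => by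
        rw [← MemLp.toLp_const_smul]
        refine MemLp.toLp_congr _ _ ?_
        filter_upwards [Lp.coeFn_smul c v.1.fst] with q hq
        have : (c • v).1.fst q = c * v.1.fst q := hq
        simp only [Pi.smul_apply, radialField, this, smul_smul, mul_assoc, RingHom.id_apply] }
  have hT₀ : ∀ v, T₀ v =ᵐ[weightMeasure s] radialField v.1.fst := fun v => (hm v).coeFn_toLp
  set C := (2 * s + 1) ^ 2 / (s - 1) ^ 2 + 2 / (s - 1) ^ 2
  have hC0 : 0 ≤ C := by positivity
  refine ⟨T₀.mkContinuous (√C) fun v => ?_, hT₀⟩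
  refine abs_le_of_sq_le_sq' ?_ (by positivity) |>.2
  obtain ⟨hi, hle⟩ := (hW v v.2).integrable_sq_mul_inv_sq hs (Lp.memLp _) (Lp.memLp _)
  rw [mul_pow, Real.sq_sqrt hC0, norm_sq_eq_integral]
  have e1 : ∫ q, v.1.fst q ^ 2 ∂weightMeasure s = ‖v.1.fst‖ ^ 2 := by
    rw [norm_sq_eq_integral]; simp
  rw [e1, ← norm_sq_eq_integral v.1.snd] at hle
  have hn : ‖v‖ ^ 2 = ‖v.1.fst‖ ^ 2 + ‖v.1.snd‖ ^ 2 := WithLp.prod_norm_sq_eq_of_L2 v.1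
  calc ∫ q, ‖T₀ v q‖ ^ 2 ∂weightMeasure s
      ≤ ∫ q, v.1.fst q ^ 2 * (1 - ‖q‖ ^ 2)⁻¹ ^ 2 ∂weightMeasure s := by
        refine integral_mono_ae ((Lp.memLp (T₀ v)).integrable_norm_pow two_ne_zero) hi ?_
        filter_upwards [hT₀ v, norm_radialField_le (s := s) v.1.fst] with q h1 h2
        rw [h1, ← mul_pow, ← sq_abs (_ * _), ← Real.norm_eq_abs]
        gcongr
    _ ≤ C * ‖v‖ ^ 2 := by
        refine hle.trans ?_
        rw [hn]
        have h1 : 0 ≤ (2 * s + 1) ^ 2 / (s - 1) ^ 2 * ‖v.1.snd‖ ^ 2 := by positivity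
        have h2 : 0 ≤ 2 / (s - 1) ^ 2 * ‖v.1.fst‖ ^ 2 := by positivity
        simp only [C]
        linarith

theorem memLp_smul_matrix (K : Matrix (Fin 3) (Fin 3) ℝ) (f : L2 s) :
    MemLp (fun q => f q • Matrix.toEuclideanLin K q) 2 (weightMeasure s) := by
  set A : Config →L[ℝ] Config := LinearMap.toContinuousLinearMap (Matrix.toEuclideanLin K)
  refine ((Lp.memLp f).const_mul ‖A‖).mono
    ((Lp.memLp f).1.smul A.continuous.aestronglyMeasurable) ?_
  filter_upwards [ae_mem_Ω s] with q hq
  have h1 : ‖q‖ < 1 := by simpa [Ω] using hq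
  have h2 : ‖A q‖ ≤ ‖A‖ := (A.le_opNorm q).trans (mul_le_of_le_one_right (norm_nonneg _) h1.le)
  rw [norm_smul, norm_mul, norm_norm, mul_comm]
  exact mul_le_mul_of_nonneg_right h2 (norm_nonneg _)

theorem ip_convect (K : Matrix (Fin 3) (Fin 3) ℝ) (f : L2 s) (G : L2Vec s) :
    ip s f (convect K G) = inner ℝ ((memLp_smul_matrix K f).toLp _) G := by
  rw [L2.inner_def, ip]
  refine integral_congr_ae ?_
  filter_upwards [(memLp_smul_matrix K f).coeFn_toLp] with q hq
  rw [hq, real_inner_smul_left, convect]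

/-! ### Existence and uniqueness by Lax–Milgram -/

theorem existsUnique_isBDF2Step (b De Δt : ℝ) (hDe : 0 < De) (hΔt : 0 < Δt)
    (hs : 1 < s) (hsb : s ≤ b / 2)
    (hstep : s < b / 2 → (b - 2 * s) / De * gammaThreshold s < 3 / (2 * Δt))
    (K : Matrix (Fin 3) (Fin 3) ℝ) (hcur hprev : L2 s) :
    ∃! hnext : H1 s, IsBDF2Step b De Δt s K hcur hprev hnext := by
  obtain ⟨W, hWc, hW⟩ := exists_submodule_mem_iff_isWeakGradient (s := s) (by linarith)
  have : CompleteSpace W := hWc.completeSpace_coe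
  obtain ⟨T, hT⟩ := exists_radialField_clm hs (fun x hx => (hW x).1 hx)
  let P : W →L[ℝ] L2 s := (WithLp.fstL 2 ℝ (L2 s) (L2Vec s)).comp W.subtypeL
  let Q : W →L[ℝ] L2Vec s := (WithLp.sndL 2 ℝ (L2 s) (L2Vec s)).comp W.subtypeL
  let J₁ : L2 s →L[ℝ] L2 s →L[ℝ] ℝ := (isBoundedBilinearMap_inner (𝕜 := ℝ)).toContinuousLinearMap
  let J₂ : L2Vec s →L[ℝ] L2Vec s →L[ℝ] ℝ :=
    (isBoundedBilinearMap_inner (𝕜 := ℝ)).toContinuousLinearMap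
  let B : W →L[ℝ] W →L[ℝ] ℝ := (3 / (2 * Δt)) • J₁.bilinearComp P P +
    (1 / De) • J₂.bilinearComp Q Q + ((b - 2 * s) / De) • J₂.bilinearComp T Q
  let k : L2Vec s := (memLp_smul_matrix K (2 • hcur - hprev)).toLp _
  let ℓ : W →L[ℝ] ℝ := (1 / (2 * Δt)) • (J₁ (4 • hcur - hprev)).comp P + (J₂ k).comp Q
  have hBapp : ∀ v w : W, B v w = 3 / (2 * Δt) * inner ℝ (P v) (P w) +
      1 / De * inner ℝ (Q v) (Q w) + (b - 2 * s) / De * inner ℝ (T v) (Q w) := fun v w => rfl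
  have hℓapp : ∀ w : W, ℓ w = 1 / (2 * Δt) * inner ℝ (4 • hcur - hprev) (P w) +
      inner ℝ k (Q w) := fun w => rfl
  have hTQ : ∀ (v : W) (G : L2Vec s),
      inner ℝ (T v) G = ip s (P v) (radial G) := by
    intro v G
    rw [L2.inner_def, ip]
    refine integral_congr_ae ?_
    filter_upwards [hT v] with q hq
    rw [hq, inner_radialField]
    rfl
  have hcoer : IsCoercive B := by
    have hb0 : 0 ≤ (b - 2 * s) / De := div_nonneg (by linarith) hDe.le
    -- At s = b/2 the potential coefficient vanishes, so no step size condition is needed.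
    have hc : 0 < 3 / (2 * Δt) - (b - 2 * s) / De * gammaThreshold s := by
      rcases hsb.lt_or_eq with h | h
      · exact sub_pos.2 (hstep h)
      · rw [show b - 2 * s = 0 by linarith]
        simp only [zero_div, zero_mul, sub_zero]
        positivity
    -- On the diagonal the mass term minus the γ(s) loss controls ‖u‖², and the diffusion term
    -- controls ‖∇u‖².
    refine ⟨min (3 / (2 * Δt) - (b - 2 * s) / De * gammaThreshold s) (1 / De),
      lt_min hc (by positivity), fun v => ?_⟩
    have hn : ‖v‖ * ‖v‖ = ‖P v‖ ^ 2 + ‖Q v‖ ^ 2 := by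
      rw [← sq]; exact WithLp.prod_norm_sq_eq_of_L2 v.1
    have hγ := ((hW v).1 v.2).neg_gammaThreshold_mul_le hs (Lp.memLp _) (Lp.memLp _)
    have e1 : ∫ q, v.1.fst q ^ 2 ∂weightMeasure s = ‖P v‖ ^ 2 := by
      rw [norm_sq_eq_integral]
      simp only [Real.norm_eq_abs, sq_abs]
      rfl
    have hγ' : -(gammaThreshold s * ‖P v‖ ^ 2) ≤ inner ℝ (T v) (Q v) := by
      rw [hTQ, ← e1]; exact hγ
    rw [hBapp, real_inner_self_eq_norm_sq, real_inner_self_eq_norm_sq, mul_assoc, hn, mul_add]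
    have m1 := mul_le_mul_of_nonneg_right
      (min_le_left (3 / (2 * Δt) - (b - 2 * s) / De * gammaThreshold s) (1 / De))
      (sq_nonneg ‖P v‖)
    have m2 := mul_le_mul_of_nonneg_right
      (min_le_right (3 / (2 * Δt) - (b - 2 * s) / De * gammaThreshold s) (1 / De))
      (sq_nonneg ‖Q v‖)
    have m3 := mul_le_mul_of_nonneg_left hγ' hb0
    linarith
  -- The map u ↦ (u, ∇u) identifies H¹_s with W; surjectivity rests on uniqueness of the weak
  -- gradient.
  let toW : H1 s → W := fun g =>
    ⟨WithLp.toLp 2 ((g : L2 s), grad g), (hW _).2 (isWeakGradient_grad g)⟩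
  have hPto : ∀ g, P (toW g) = g := fun g => rfl
  have hQto : ∀ g, Q (toW g) = grad g := fun g => rfl
  have hsurj : ∀ w : W, ∃ g : H1 s, toW g = w := by
    intro w
    refine ⟨⟨w.1.fst, w.1.snd, (hW w).1 w.2⟩, Subtype.ext ?_⟩
    have := grad_unique ⟨w.1.fst, w.1.snd, (hW w).1 w.2⟩ w.1.snd ((hW w).1 w.2)
    simp only [toW, ← this]
    rfl
  have hinj : Function.Injective toW := fun g g' h => Subtype.ext (congrArg P h)
  have hiff : ∀ h : H1 s, IsBDF2Step b De Δt s K hcur hprev h ↔ ∀ w, B (toW h) w = ℓ w := by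
    intro h
    have hw : (∀ w, B (toW h) w = ℓ w) ↔ ∀ g, B (toW h) (toW g) = ℓ (toW g) :=
      ⟨fun H g => H _, fun H w => by obtain ⟨g, rfl⟩ := hsurj w; exact H g⟩
    rw [hw]
    refine forall_congr' fun g => ?_
    have e1 : ip s (fun q => 3 * (h : L2 s) q - 4 * hcur q + hprev q) (g : L2 s) =
        inner ℝ ((3 : ℝ) • (h : L2 s) - (4 • hcur - hprev)) (g : L2 s) := by
      rw [← ip_eq_inner]
      refine integral_congr_ae ?_
      filter_upwards [Lp.coeFn_sub ((3 : ℝ) • (h : L2 s)) (4 • hcur - hprev),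
        Lp.coeFn_sub (4 • hcur) hprev, Lp.coeFn_smul (3 : ℝ) (h : L2 s),
        Lp.coeFn_smul (4 : ℝ) hcur] with q h1 h2 h3 h4
      rw [show (4 : ℝ) • hcur = 4 • hcur by norm_cast] at h4
      simp only [h1, h2, h3, h4, Pi.sub_apply, Pi.smul_apply, smul_eq_mul]
      ring
    have e2 : ip s (fun q => 2 * hcur q - hprev q) (convect K (grad g)) = inner ℝ k (grad g) := by
      rw [← ip_convect]
      refine integral_congr_ae ?_
      filter_upwards [Lp.coeFn_sub (2 • hcur) hprev, Lp.coeFn_smul (2 : ℝ) hcur] with q h1 h2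
      rw [show (2 : ℝ) • hcur = 2 • hcur by norm_cast] at h2
      simp only [h1, h2, Pi.sub_apply, Pi.smul_apply, smul_eq_mul]
    rw [hBapp, hℓapp, hTQ, e1, e2, hPto, hPto, hQto, hQto, ipVec_eq_inner, inner_sub_left,
      real_inner_smul_left]
    have hdt : (3 : ℝ) / (2 * Δt) = 1 / (2 * Δt) * 3 := by ring
    rw [hdt]
    constructor <;> intro H <;> linarith
  obtain ⟨v, hv, hvu⟩ := existsUnique_of_isCoercive hcoer ℓ
  obtain ⟨h, rfl⟩ := hsurj v
  exact ⟨h, (hiff h).2 hv, fun h' hh' => hinj (hvu _ ((hiff h').1 hh'))⟩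

end FENE

end

theorem mainTheorem1 (b De Δt s : ℝ) (hDe : 0 < De) (hΔt : 0 < Δt)
    (hs : 1 < s) (hsb : s ≤ b / 2)
    (hstep : s < b / 2 → (b - 2 * s) / De * FENE.gammaThreshold s < 3 / (2 * Δt))
    (K : Matrix (Fin 3) (Fin 3) ℝ) :
    (∀ u g : FENE.H1 s,
      Integrable (fun q => (u : FENE.L2 s) q * FENE.radial (FENE.grad g) q)
        (FENE.weightMeasure s)) ∧
    ∀ hcur hprev : FENE.L2 s,
      ∃! hnext : FENE.H1 s, FENE.IsBDF2Step b De Δt s K hcur hprev hnext :=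
  ⟨fun u _ => FENE.integrable_mul_radial
    ((FENE.isWeakGradient_grad u).memLp_mul_inv hs (Lp.memLp _) (Lp.memLp _)) (Lp.memLp _),
    fun hcur hprev => FENE.existsUnique_isBDF2Step b De Δt hDe hΔt hs hsb hstep K hcur hprev⟩
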